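/- Let $n,m,T$ be positive integers, and consider the linear system $x(t+1)=A_{\rm true}x(t)+B_{\rm true}u(t)$ with $A_{\rm true}\in\mathbb{R}^{n\times n}$ and $B_{\rm true}\in\mathbb{R}^{n\times m}$. Let $u(0),\dots,u(T-1)\in\mathbb{R}^m$ and $x(0),\dots,x(T)\in\mathbb{R}^n$ be input and state data generated by this system, and put $U_-=[u(0)\ \cdots\ u(T-1)]$, $X_-=[x(0)\ \cdots\ x(T-1)]$, $X_+=[x(1)\ \cdots\ x(T)]$. A real square matrix is called Schur if all its complex eigenvalues have modulus less than $1$. Let $\Sigma_{\rm stab}$ be the set of stabilizable pairs, i.e. the $(A,B)\in\mathbb{R}^{n\times n}\times\mathbb{R}^{n\times m}$ such that $A+BF$ is Schur for some $F\in\mathbb{R}^{m\times n}$, and let $$\Sigma_{\mathcal D}=\{(A,B) : X_+=AX_-+BU_-\},\qquad \Sigma_{\mathcal D}^0=\{(A_0,B_0) : A_0X_-+B_0U_-=0\},$$ with $A,A_0\in\mathbb{R}^{n\times n}$ and $B,B_0\in\mathbb{R}^{n\times m}$. For a pair $(A,B)$ let $\mathcal{R}(A,B)=\operatorname{im}[B\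 AB\ \cdots\ A^{n-1}B]$ be its reachable subspace. Suppose that $(A_{\rm true},B_{\rm true})\in\Sigma_{\rm stab}$, and that $K\in\mathbb{R}^{m\times n}$ is such that $A+BK$ is Schur for all $(A,B)\in\Sigma_{\mathcal D}\cap\Sigma_{\rm stab}$. Then the following statements hold: (a) $(A_0+B_0K)\,\mathcal{R}(A,B)=\{0\}$ for all $(A,B)\in\Sigma_{\mathcal D}\cap\Sigma_{\rm stab}$ and all $(A_0,B_0)\in\Sigma_{\mathcal D}^0$. (b) If $\operatorname{rank}X_-<n$, then $\operatorname{im}\begin{bmatrix}X_-\\U_-\end{bmatrix}=\operatorname{im}X_-\times\mathbb{R}^m$. (c) $\operatorname{im}X_+\subseteq\operatorname{im}X_-$. (d) For all $(A,B)\in\Sigma_{\mathcal D}$, the subspace $\operatorname{im}X_-$ is $A$-invariant and contains $\operatorname{im}B$. -/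

import Mathlib

namespace DataDriven

/-- The set `ℳ = ℝ^{n×n} × ℝ^{n×m}` of pairs of system matrices `(A, B)`. -/
abbrev Sys (n m : ℕ) : Type := Matrix (Fin n) (Fin n) ℝ × Matrix (Fin n) (Fin m) ℝ

/-- A real square matrix is Schur if all its complex eigenvalues have modulus less than one. -/
def IsSchur {n : ℕ} (M : Matrix (Fin n) (Fin n) ℝ) : Prop :=
  ∀ μ ∈ spectrum ℂ (M.map (algebraMap ℝ ℂ)), ‖μ‖ < 1

/-- The column space of a real matrix. -/
def im {ι κ : Type} [Fintype κ] (M : Matrix ι κ ℝ) : Submodule ℝ (ι → ℝ) :=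
  LinearMap.range M.mulVecLin

/-- The set of stabilizable systems: the pairs `(A, B)` for which some feedback gain `F` makes
`A + B F` Schur. -/
def stabilizableSystems (n m : ℕ) : Set (Sys n m) :=
  {P | ∃ F : Matrix (Fin m) (Fin n) ℝ, IsSchur (P.1 + P.2 * F)}

/-- The matrix `[B  AB  ⋯  A^{n-1}B]`; the column `(k, j)` is the `j`-th column of `A^k B`. -/
def reachabilityMatrix {n m : ℕ} (A : Matrix (Fin n) (Fin n) ℝ) (B : Matrix (Fin n) (Fin m) ℝ) :
    Matrix (Fin n) (Fin n × Fin m) ℝ :=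
  Matrix.of fun i kj => (A ^ (kj.1 : ℕ) * B) i kj.2

/-- The reachable subspace `ℛ(A, B) = im [B  AB  ⋯  A^{n-1}B]`. -/
def reachableSubspace {n m : ℕ} (A : Matrix (Fin n) (Fin n) ℝ) (B : Matrix (Fin n) (Fin m) ℝ) :
    Submodule ℝ (Fin n → ℝ) :=
  im (reachabilityMatrix A B)

/-- Input-state data `u(0), …, u(T-1)` and `x(0), …, x(T)`. -/
structure Data (n m T : ℕ) where
  /-- the inputs -/
  u : Fin T → Fin m → ℝ
  /-- the states -/
  x : Fin (T + 1) → Fin n → ℝ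

namespace Data

variable {n m T : ℕ}

/-- The data are collected from the system `x(t+1) = A x(t) + B u(t)`. -/
def CollectedFrom (D : Data n m T) (A : Matrix (Fin n) (Fin n) ℝ) (B : Matrix (Fin n) (Fin m) ℝ) :
    Prop :=
  ∀ t : Fin T, D.x t.succ = A.mulVec (D.x t.castSucc) + B.mulVec (D.u t)

/-- `U₋ = [u(0) ⋯ u(T-1)]`. -/
def Uminus (D : Data n m T) : Matrix (Fin m) (Fin T) ℝ :=
  Matrix.of fun i t => D.u t i

/-- `X₋ = [x(0) ⋯ x(T-1)]`. -/
def Xminus (D : Data n m T) : Matrix (Fin n) (Fin T) ℝ :=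
  Matrix.of fun i t => D.x t.castSucc i

/-- `X₊ = [x(1) ⋯ x(T)]`. -/
def Xplus (D : Data n m T) : Matrix (Fin n) (Fin T) ℝ :=
  Matrix.of fun i t => D.x t.succ i

/-- The set of data-consistent systems, `X₊ = A X₋ + B U₋`. -/
def consistentSystems (D : Data n m T) : Set (Sys n m) :=
  {P | D.Xplus = P.1 * D.Xminus + P.2 * D.Uminus}

/-- The set of pairs with `A₀ X₋ + B₀ U₋ = 0`. -/
def homogeneousSystems (D : Data n m T) : Set (Sys n m) :=
  {P | P.1 * D.Xminus + P.2 * D.Uminus = 0}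

end Data

end DataDriven

namespace DataDriven

open Matrix Filter Topology

/-! ### Schur matrices, their powers and their traces -/

section

attribute [local instance] Matrix.linftyOpNormedRing Matrix.linftyOpNormedAlgebra

/-! Let (A, B) be consistent and stabilizable, (A₀, B₀) homogeneous, r reachable, v = (A₀ + B₀K)r
and S = r vᵀ. The pairs (A + tSA₀, B + tSB₀) fit the data and differ from (A, B) only by maps into
ℛ(A, B). For large t their reachable subspace still contains ℛ(A, B), so they are stabilizable:
deadbeat feedback acts on ℛ(A, B), and modulo it nothing has changed
(`eventually_mem_stabilizableSystems`). Hence A + BK + tS(A₀ + B₀K) is Schur. Its trace is bounded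
by n but grows like t(v ⬝ᵥ v), so v = 0; this is (a).

Taking A₀ = ξξᵀ, B₀ = 0 with ξ ⊥ im X₋ in (a) gives ℛ(A, B) ⊆ im X₋. If rank X₋ < n, some such ξ is
nonzero, and a small perturbation along ξ shows that every left annihilator (p, q) of the stacked
data has q = 0; by duality this is (b). Since m > 0, (b) gives c ≠ 0 with X₋c = 0, and this linear
dependence traps the trajectory in im X₋, which is (c). By (b) again, every (x, u) with x ∈ im X₋ is
a combination of data columns, so Ax + Bu ∈ im X₊ ⊆ im X₋, which is (d). At full rank (c) and (d)
are trivial. -/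

theorem tendsto_pow_zero_of_forall_spectrum {A : Type*} [NormedRing A] [NormedAlgebra ℂ A]
    [CompleteSpace A] (a : A) (h : ∀ μ ∈ spectrum ℂ a, ‖μ‖ < 1) :
    Tendsto (fun k : ℕ => a ^ k) atTop (𝓝 0) := by
  rcases subsingleton_or_nontrivial A with hA | hA
  · exact tendsto_const_nhds.congr fun k => Subsingleton.elim _ _
  have hρ : spectralRadius ℂ a < 1 := by
    have := spectrum.spectralRadius_lt_of_forall_lt a (r := 1) (fun μ hμ => by
      have := h μ hμ
      exact_mod_cast this)
    simpa using this
  obtain ⟨r, hr, hr1⟩ := exists_between hρ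
  have hev := (spectrum.pow_nnnorm_pow_one_div_tendsto_nhds_spectralRadius a).eventually_lt_const hr
  lift r to NNReal using hr1.ne_top
  have hr1' : r < 1 := by exact_mod_cast hr1
  refine squeeze_zero_norm' ?_ (tendsto_pow_atTop_nhds_zero_of_lt_one r.2 (by exact_mod_cast hr1'))
  filter_upwards [hev, eventually_gt_atTop 0] with k hk hk0
  have hk0' : (0 : ℝ) < k := by exact_mod_cast hk0
  have h1 := ENNReal.rpow_le_rpow hk.le hk0'.le
  rw [← ENNReal.rpow_mul, one_div, inv_mul_cancel₀ hk0'.ne', ENNReal.rpow_one,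
    ENNReal.rpow_natCast] at h1
  exact_mod_cast h1

theorem IsSchur.tendsto_pow {n : ℕ} {M : Matrix (Fin n) (Fin n) ℝ} (h : IsSchur M) :
    Tendsto (fun k : ℕ => M ^ k) atTop (𝓝 0) := by
  have h1 := tendsto_pow_zero_of_forall_spectrum _ h
  have h2 : Continuous fun C : Matrix (Fin n) (Fin n) ℂ => C.map Complex.re :=
    continuous_id.matrix_map Complex.continuous_re
  have h3 := (h2.tendsto 0).comp h1
  simp only [Complex.zero_re, Matrix.map_zero] at h3
  refine h3.congr fun k => ?_
  have := (map_pow (algebraMap ℝ ℂ).mapMatrix M k).symm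
  simp only [RingHom.mapMatrix_apply] at this
  simp only [Function.comp_apply]
  rw [this]
  ext i j
  simp

/-- A single small power certifies stability, and for fixed k this condition is open in M. The
factor `‖1‖` is kept because the identity has norm 0 when n = 0. -/
theorem isSchur_of_norm_pow_lt {n : ℕ} {M : Matrix (Fin n) (Fin n) ℝ} (k : ℕ)
    (h : ‖(M.map (algebraMap ℝ ℂ)) ^ k‖ * ‖(1 : Matrix (Fin n) (Fin n) ℂ)‖ < 1) : IsSchur M := by
  intro μ hμ
  have h1 := spectrum.norm_le_norm_mul_of_mem (spectrum.pow_mem_pow _ k hμ)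
  rw [norm_pow] at h1
  by_contra! hc
  exact absurd (h1.trans_lt h) (not_lt.2 (one_le_pow₀ hc))

theorem tendsto_map_pow {n : ℕ} {M : Matrix (Fin n) (Fin n) ℝ}
    (h : Tendsto (fun k : ℕ => M ^ k) atTop (𝓝 0)) :
    Tendsto (fun k : ℕ => ‖(M.map (algebraMap ℝ ℂ)) ^ k‖ * ‖(1 : Matrix (Fin n) (Fin n) ℂ)‖)
      atTop (𝓝 0) := by
  have h2 : Continuous fun C : Matrix (Fin n) (Fin n) ℝ => C.map (algebraMap ℝ ℂ) :=
    continuous_id.matrix_map Complex.continuous_ofReal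
  have h3 := ((h2.tendsto 0).comp h).norm.mul_const ‖(1 : Matrix (Fin n) (Fin n) ℂ)‖
  simp only [map_zero, Matrix.map_zero, norm_zero, zero_mul] at h3
  refine h3.congr fun k => ?_
  have := map_pow (algebraMap ℝ ℂ).mapMatrix M k
  simp only [RingHom.mapMatrix_apply] at this
  simp only [Function.comp_apply, this]

theorem isSchur_of_tendsto_pow {n : ℕ} {M : Matrix (Fin n) (Fin n) ℝ}
    (h : Tendsto (fun k : ℕ => M ^ k) atTop (𝓝 0)) : IsSchur M := by
  obtain ⟨k, hk⟩ := ((tendsto_map_pow h).eventually_lt_const one_pos).exists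
  exact isSchur_of_norm_pow_lt k hk

theorem IsSchur.eventually {n : ℕ} {M : ℝ → Matrix (Fin n) (Fin n) ℝ} (hM : Continuous M)
    (h : IsSchur (M 0)) : ∀ᶠ t in 𝓝 0, IsSchur (M t) := by
  obtain ⟨k, hk⟩ := ((tendsto_map_pow h.tendsto_pow).eventually_lt_const one_pos).exists
  have hc : Continuous fun t => ‖((M t).map (algebraMap ℝ ℂ)) ^ k‖ *
      ‖(1 : Matrix (Fin n) (Fin n) ℂ)‖ := by
    have : Continuous fun t => (M t).map (algebraMap ℝ ℂ) :=
      hM.matrix_map Complex.continuous_ofReal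
    exact ((this.pow k).norm).mul continuous_const
  filter_upwards [(hc.tendsto 0).eventually_lt_const hk] with t ht
  exact isSchur_of_norm_pow_lt k ht

/-- The trace is the sum of n eigenvalues in the unit disc. This prevents a ray of Schur matrices
from having unbounded trace. -/
theorem IsSchur.abs_trace_le {n : ℕ} {M : Matrix (Fin n) (Fin n) ℝ} (h : IsSchur M) :
    |M.trace| ≤ n := by
  have h1 := Matrix.trace_eq_sum_roots_charpoly (M.map (algebraMap ℝ ℂ))
  have h2 : (M.map (algebraMap ℝ ℂ)).trace = (M.trace : ℂ) := by
    simp [Matrix.trace]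
  have h3 : ‖((M.map (algebraMap ℝ ℂ)).charpoly.roots).sum‖ ≤ n := by
    refine (norm_multiset_sum_le _).trans ?_
    refine (Multiset.sum_le_card_nsmul _ 1 ?_).trans ?_
    · intro x hx
      obtain ⟨μ, hμ, rfl⟩ := Multiset.mem_map.1 hx
      exact (h μ (Matrix.mem_spectrum_of_isRoot_charpoly (Polynomial.isRoot_of_mem_roots hμ))).le
    · have := (Polynomial.card_roots' (M.map (algebraMap ℝ ℂ)).charpoly)
      rw [Matrix.charpoly_natDegree_eq_dim, Fintype.card_fin] at this
      simpa using this
  rw [← h1, h2, Complex.norm_real] at h3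
  exact h3

/-- If `N` leaves `R` invariant, is nilpotent on `R`, and agrees modulo `R` with a Schur matrix,
then `N` is Schur. -/
theorem IsSchur.of_congr_mod {n : ℕ} {M N : Matrix (Fin n) (Fin n) ℝ} (hM : IsSchur M)
    (R : Submodule ℝ (Fin n → ℝ)) (hN : ∀ x ∈ R, N *ᵥ x ∈ R)
    (hMN : ∀ x, (N - M) *ᵥ x ∈ R) (l : ℕ) (hl : ∀ x ∈ R, (N ^ l) *ᵥ x = 0) : IsSchur N := by
  have h1 : ∀ k : ℕ, ∀ x, (N ^ k - M ^ k) *ᵥ x ∈ R := by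
    intro k
    induction k with
    | zero => intro x; simp
    | succ k ih =>
      intro x
      have : N ^ (k + 1) - M ^ (k + 1) = N * (N ^ k - M ^ k) + (N - M) * M ^ k := by
        rw [pow_succ' N, pow_succ' M]; noncomm_ring
      rw [this, add_mulVec, ← mulVec_mulVec, ← mulVec_mulVec]
      exact R.add_mem (hN _ (ih x)) (hMN _)
  -- The discrepancy between the k-th powers lands in R, where `N ^ l` vanishes.
  have h2 : ∀ k : ℕ, N ^ (k + l) = N ^ l * M ^ k := by
    intro k
    have : N ^ l * (N ^ k - M ^ k) = 0 := by
      apply Matrix.ext_of_mulVec_single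
      intro i
      rw [← mulVec_mulVec, hl _ (h1 k _), zero_mulVec]
    rw [mul_sub, sub_eq_zero] at this
    rw [add_comm, pow_add, this]
  apply isSchur_of_tendsto_pow
  rw [← tendsto_add_atTop_iff_nat l]
  simp only [h2]
  simpa using hM.tendsto_pow.const_mul (N ^ l)

end

/-! ### The reachable subspace -/

theorem mem_reachableSubspace {n m : ℕ} {A : Matrix (Fin n) (Fin n) ℝ}
    {B : Matrix (Fin n) (Fin m) ℝ} {x : Fin n → ℝ} :
    x ∈ reachableSubspace A B ↔
      ∃ w : Fin n × Fin m → ℝ, ∑ k : Fin n, (A ^ (k : ℕ) * B) *ᵥ (fun j => w (k, j)) = x := by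
  have h : ∀ w : Fin n × Fin m → ℝ, reachabilityMatrix A B *ᵥ w =
      ∑ k : Fin n, (A ^ (k : ℕ) * B) *ᵥ (fun j => w (k, j)) := by
    intro w
    ext i
    simp only [Matrix.mulVec, dotProduct, reachabilityMatrix, Matrix.of_apply,
      Fintype.sum_prod_type, Finset.sum_apply]
  simp only [reachableSubspace, im, LinearMap.mem_range, Matrix.mulVecLin_apply, h]

theorem pow_mulVec_mem {n : ℕ} {A : Matrix (Fin n) (Fin n) ℝ} {R : Submodule ℝ (Fin n → ℝ)}
    (hA : ∀ x ∈ R, A *ᵥ x ∈ R) (k : ℕ) : ∀ x ∈ R, (A ^ k) *ᵥ x ∈ R := by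
  induction k with
  | zero => simp
  | succ k ih =>
    intro x hx
    rw [pow_succ', ← mulVec_mulVec]
    exact hA _ (ih x hx)

theorem reachableSubspace_le {n m : ℕ} {A : Matrix (Fin n) (Fin n) ℝ}
    {B : Matrix (Fin n) (Fin m) ℝ} {R : Submodule ℝ (Fin n → ℝ)}
    (hA : ∀ x ∈ R, A *ᵥ x ∈ R) (hB : ∀ u, B *ᵥ u ∈ R) : reachableSubspace A B ≤ R := by
  intro x hx
  obtain ⟨w, rfl⟩ := mem_reachableSubspace.1 hx
  refine R.sum_mem fun k _ => ?_
  rw [← mulVec_mulVec]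
  exact pow_mulVec_mem hA _ _ (hB _)

theorem pow_mul_mulVec_mem_of_lt {n m : ℕ} (A : Matrix (Fin n) (Fin n) ℝ)
    (B : Matrix (Fin n) (Fin m) ℝ) {k : ℕ} (hk : k < n) (u : Fin m → ℝ) :
    (A ^ k * B) *ᵥ u ∈ reachableSubspace A B := by
  rw [mem_reachableSubspace]
  refine ⟨fun p => if p.1 = ⟨k, hk⟩ then u p.2 else 0, ?_⟩
  rw [Finset.sum_eq_single ⟨k, hk⟩]
  · simp
  · intro b _ hb
    simp only [hb, if_false]
    exact mulVec_zero _
  · simp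

/-- By Cayley–Hamilton, every power of A is a combination of those with exponent below n. -/
theorem pow_mul_mulVec_mem {n m : ℕ} (A : Matrix (Fin n) (Fin n) ℝ)
    (B : Matrix (Fin n) (Fin m) ℝ) (k : ℕ) (u : Fin m → ℝ) :
    (A ^ k * B) *ᵥ u ∈ reachableSubspace A B := by
  rcases Nat.eq_zero_or_pos n with rfl | hn
  · rw [Subsingleton.elim ((A ^ k * B) *ᵥ u) 0]
    exact Submodule.zero_mem _
  rw [Matrix.pow_eq_aeval_mod_charpoly, Polynomial.aeval_eq_sum_range' (n := n), Matrix.sum_mul,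
    Matrix.sum_mulVec]
  · refine Submodule.sum_mem _ fun i hi => ?_
    rw [Matrix.smul_mul, smul_mulVec]
    exact Submodule.smul_mem _ _ (pow_mul_mulVec_mem_of_lt A B (Finset.mem_range.1 hi) u)
  · have h := Polynomial.natDegree_modByMonic_lt (Polynomial.X ^ k) A.charpoly_monic (by
      intro h
      have := A.charpoly_natDegree_eq_dim
      rw [h, Polynomial.natDegree_one, Fintype.card_fin] at this
      omega)
    rwa [A.charpoly_natDegree_eq_dim, Fintype.card_fin] at h

theorem mulVec_mem_reachableSubspace {n m : ℕ} (A : Matrix (Fin n) (Fin n) ℝ)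
    (B : Matrix (Fin n) (Fin m) ℝ) (u : Fin m → ℝ) : B *ᵥ u ∈ reachableSubspace A B := by
  simpa using pow_mul_mulVec_mem A B 0 u

theorem reachableSubspace_invariant {n m : ℕ} (A : Matrix (Fin n) (Fin n) ℝ)
    (B : Matrix (Fin n) (Fin m) ℝ) :
    ∀ x ∈ reachableSubspace A B, A *ᵥ x ∈ reachableSubspace A B := by
  intro x hx
  obtain ⟨w, rfl⟩ := mem_reachableSubspace.1 hx
  rw [Matrix.mulVec_sum]
  refine Submodule.sum_mem _ fun k _ => ?_
  rw [mulVec_mulVec, ← Matrix.mul_assoc, ← pow_succ']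
  exact pow_mul_mulVec_mem A B _ _

/-! ### Deadbeat feedback on the reachable subspace -/

/-- A feedback that moves each member of an increasing chain of subspaces into the previous one,
provided every single state of a member can be moved by some input. -/
theorem exists_feedback_of_chain {K E U : Type*} [Field K] [AddCommGroup E] [Module K E]
    [AddCommGroup U] [Module K U] (A : E →ₗ[K] E) (B : U →ₗ[K] E) (V : ℕ → Submodule K E)
    (h0 : V 0 = ⊥) (hmono : Monotone V) (hstep : ∀ k, ∀ x ∈ V (k + 1), ∃ u, A x + B u ∈ V k) (k : ℕ) :
    ∃ F : E →ₗ[K] U, ∀ j < k, ∀ x ∈ V (j + 1), A x + B (F x) ∈ V j := by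
  induction k with
  | zero => exact ⟨0, by simp⟩
  | succ k ih =>
    obtain ⟨F, hF⟩ := ih
    obtain ⟨p, hp⟩ := (V k).subtype.exists_leftInverse_of_injective (by simp)
    obtain ⟨q, hq⟩ := (V (k + 1)).subtype.exists_leftInverse_of_injective (by simp)
    have hp' : ∀ x (hx : x ∈ V k), p x = ⟨x, hx⟩ := fun x hx =>
      LinearMap.congr_fun hp ⟨x, hx⟩
    have hq' : ∀ x (hx : x ∈ V (k + 1)), q x = ⟨x, hx⟩ := fun x hx =>
      LinearMap.congr_fun hq ⟨x, hx⟩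
    let W : Submodule K (E × U) := (V k).comap (A.coprod B)
    -- The admissible pairs (x, u) form a subspace projecting onto `V (k + 1)`; a linear section
    -- picks u linearly in x.
    have hsurj : ∃ G : V (k + 1) →ₗ[K] U, ∀ x : V (k + 1), A x + B (G x) ∈ V k := by
      let f : ↥(W ⊓ (V (k + 1)).comap (LinearMap.fst K E U)) →ₗ[K] V (k + 1) :=
        LinearMap.codRestrict _ ((LinearMap.fst K E U).comp (Submodule.subtype _))
          (fun c => c.2.2)
      have hf : Function.Surjective f := by
        rintro ⟨x, hx⟩
        obtain ⟨u, hu⟩ := hstep k x hx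
        exact ⟨⟨(x, u), hu, hx⟩, rfl⟩
      obtain ⟨g, hg⟩ := f.exists_rightInverse_of_surjective (LinearMap.range_eq_top.2 hf)
      refine ⟨(LinearMap.snd K E U).comp ((Submodule.subtype _).comp g), fun x => ?_⟩
      have h1 : ((g x : E × U)).1 = x := congrArg Subtype.val (LinearMap.congr_fun hg x)
      have h2 : A (g x : E × U).1 + B (g x : E × U).2 ∈ V k := (g x).2.1
      rw [h1] at h2
      exact h2
    obtain ⟨G, hG⟩ := hsurj
    let P : E →ₗ[K] E := (V k).subtype.comp p
    -- The old feedback acts on the `V k` component, the new one on the remainder.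
    refine ⟨F.comp P + (G.comp q).comp (LinearMap.id - P), fun j hj x hx => ?_⟩
    rcases Nat.lt_succ_iff_lt_or_eq.1 hj with hj | rfl
    · have hPx : P x = x := by
        have := hp' x (hmono hj hx)
        simp [P, this]
      simpa [hPx] using hF j hj x hx
    · have hPx : P x ∈ V j := (p x).2
      have hPx' : P x ∈ V (j + 1) := hmono j.le_succ hPx
      have h1 : A (P x) + B (F (P x)) ∈ V j := by
        rcases Nat.eq_zero_or_pos j with rfl | hj
        · rw [h0, Submodule.mem_bot] at hPx
          simp [hPx]
        · have := hF (j - 1) (by omega) (P x) (by rwa [Nat.sub_add_cancel hj])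
          exact hmono (Nat.sub_le _ _) this
      have h2 := hG (q (x - P x))
      have h4 : ((q (x - P x) : V (j + 1)) : E) = x - P x := by
        rw [hq' _ (Submodule.sub_mem _ hx hPx')]
      rw [h4] at h2
      have h3 := (V j).add_mem h1 h2
      convert h3 using 1
      simp only [LinearMap.add_apply, LinearMap.comp_apply, LinearMap.sub_apply, LinearMap.id_apply,
        map_add, map_sub]
      abel

/-- The states that can be steered to the origin in `k` steps. -/
def controllableTo {n m : ℕ} (A : Matrix (Fin n) (Fin n) ℝ) (B : Matrix (Fin n) (Fin m) ℝ)
    (k : ℕ) : Submodule ℝ (Fin n → ℝ) where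
  carrier := {x | ∃ w : ℕ → Fin m → ℝ, (A ^ k) *ᵥ x = ∑ i ∈ Finset.range k, (A ^ i * B) *ᵥ w i}
  zero_mem' := ⟨0, by simp⟩
  add_mem' := by
    rintro x y ⟨w, hw⟩ ⟨v, hv⟩
    exact ⟨w + v, by simp [mulVec_add, Finset.sum_add_distrib, hw, hv]⟩
  smul_mem' := by
    rintro c x ⟨w, hw⟩
    exact ⟨c • w, by simp [mulVec_smul, Finset.smul_sum, hw]⟩

theorem mem_controllableTo {n m : ℕ} {A : Matrix (Fin n) (Fin n) ℝ}
    {B : Matrix (Fin n) (Fin m) ℝ} {k : ℕ} {x : Fin n → ℝ} :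
    x ∈ controllableTo A B k ↔
      ∃ w : ℕ → Fin m → ℝ, (A ^ k) *ᵥ x = ∑ i ∈ Finset.range k, (A ^ i * B) *ᵥ w i :=
  Iff.rfl

theorem exists_deadbeat {n m : ℕ} (A : Matrix (Fin n) (Fin n) ℝ) (B : Matrix (Fin n) (Fin m) ℝ) :
    ∃ F : Matrix (Fin m) (Fin n) ℝ,
      ∀ x ∈ reachableSubspace A B, ((A + B * F) ^ n) *ᵥ x = 0 := by
  have h0 : controllableTo A B 0 = ⊥ := by
    ext x
    simp [mem_controllableTo]
  have hmono : Monotone (controllableTo A B) := by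
    refine monotone_nat_of_le_succ fun k x hx => ?_
    obtain ⟨w, hw⟩ := mem_controllableTo.1 hx
    refine mem_controllableTo.2 ⟨fun i => if i = 0 then 0 else w (i - 1), ?_⟩
    rw [pow_succ', ← mulVec_mulVec, hw, mulVec_sum, Finset.sum_range_succ']
    simp [mulVec_mulVec, ← Matrix.mul_assoc, ← pow_succ']
  obtain ⟨F, hF⟩ := exists_feedback_of_chain A.mulVecLin B.mulVecLin (controllableTo A B) h0 hmono
    (by
      intro k x hx
      obtain ⟨w, hw⟩ := mem_controllableTo.1 hx
      -- In the expansion of A^(k+1) x, the term A^k B (w k) is absorbed by the current input.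
      refine ⟨-w k, mem_controllableTo.2 ⟨w, ?_⟩⟩
      rw [Finset.sum_range_succ, pow_succ, ← mulVec_mulVec] at hw
      simp [mulVec_add, mulVec_neg, hw, mulVec_mulVec]) n
  refine ⟨LinearMap.toMatrix' F, fun x hx => ?_⟩
  have hN : ∀ x, (A + B * LinearMap.toMatrix' F) *ᵥ x = A *ᵥ x + B *ᵥ F x := by
    intro x
    rw [add_mulVec, ← mulVec_mulVec, LinearMap.toMatrix'_mulVec]
  have hind : ∀ k ≤ n, ∀ x ∈ controllableTo A B k,
      ((A + B * LinearMap.toMatrix' F) ^ k) *ᵥ x = 0 := by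
    intro k
    induction k with
    | zero => intro _ x hx; simpa [h0] using hx
    | succ k ih =>
      intro hk x hx
      rw [pow_succ, ← mulVec_mulVec, hN]
      exact ih (by omega) _ (hF k hk x hx)
  refine hind n le_rfl x (mem_controllableTo.2 ?_)
  obtain ⟨w, hw⟩ := mem_reachableSubspace.1
    (pow_mulVec_mem (reachableSubspace_invariant A B) n x hx)
  refine ⟨fun i j => if h : i < n then w (⟨i, h⟩, j) else 0, ?_⟩
  rw [← hw, Finset.sum_range]
  simp

/-! ### Stabilizability along perturbations inside the reachable subspace -/

open Polynomial in
-- Preserving reachability amounts to the nonvanishing of a polynomial in t that equals 1 at t = 0,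
-- so it can fail for only finitely many t.
theorem eventually_reachableSubspace_le {n m : ℕ} (A A' : Matrix (Fin n) (Fin n) ℝ)
    (B B' : Matrix (Fin n) (Fin m) ℝ) (hA' : ∀ x, A' *ᵥ x ∈ reachableSubspace A B)
    (hB' : ∀ u, B' *ᵥ u ∈ reachableSubspace A B) :
    ∀ᶠ t : ℝ in atTop,
      reachableSubspace A B ≤ reachableSubspace (A + t • A') (B + t • B') := by
  set R := reachableSubspace A B
  set Cm := reachabilityMatrix A B with hCm
  obtain ⟨p, hp⟩ := R.subtype.exists_leftInverse_of_injective (by simp)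
  obtain ⟨g, hg⟩ := Cm.mulVecLin.rangeRestrict.exists_rightInverse_of_surjective
    (LinearMap.range_rangeRestrict _)
  -- Q is a section of the reachability matrix composed with a projection onto R, so `Cm * Q` is
  -- that projection.
  let Q : Matrix (Fin n × Fin m) (Fin n) ℝ := LinearMap.toMatrix' (g.comp p)
  have hQ : ∀ x, (Cm * Q) *ᵥ x = (p x : Fin n → ℝ) := by
    intro x
    rw [← mulVec_mulVec, LinearMap.toMatrix'_mulVec]
    exact congrArg Subtype.val (LinearMap.congr_fun hg (p x))
  have hp' : ∀ x ∈ R, (p x : Fin n → ℝ) = x := fun x hx =>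
    congrArg Subtype.val (LinearMap.congr_fun hp ⟨x, hx⟩)
  let Ap : Matrix (Fin n) (Fin n) ℝ[X] := A.map C + (X : ℝ[X]) • A'.map C
  let Bp : Matrix (Fin n) (Fin m) ℝ[X] := B.map C + (X : ℝ[X]) • B'.map C
  let Gp : Matrix (Fin n) (Fin n) ℝ[X] :=
    Matrix.of (fun i (kj : Fin n × Fin m) => (Ap ^ (kj.1 : ℕ) * Bp) i kj.2) * Q.map C +
      (1 - Cm * Q).map C
  have hAp : ∀ t, Ap.map (evalRingHom t) = A + t • A' := by
    intro t; ext i j; simp [Ap, mul_comm (A' i j)]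
  have hBp : ∀ t, Bp.map (evalRingHom t) = B + t • B' := by
    intro t; ext i j; simp [Bp, mul_comm (B' i j)]
  have hGp : ∀ t, Gp.map (evalRingHom t) =
      reachabilityMatrix (A + t • A') (B + t • B') * Q + (1 - Cm * Q) := by
    intro t
    have h1 : (Matrix.of (fun i (kj : Fin n × Fin m) =>
        (Ap ^ (kj.1 : ℕ) * Bp) i kj.2)).map (evalRingHom t) =
        reachabilityMatrix (A + t • A') (B + t • B') := by
      ext i kj
      have h2 : (Ap ^ (kj.1 : ℕ) * Bp).map (evalRingHom t) =
          (A + t • A') ^ (kj.1 : ℕ) * (B + t • B') := by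
        rw [Matrix.map_mul, hBp, ← hAp, ← RingHom.mapMatrix_apply, map_pow,
          RingHom.mapMatrix_apply]
      exact congrFun (congrFun h2 i) kj.2
    have h3 : ∀ {l : Type} (M : Matrix l (Fin n) ℝ), (M.map C).map (evalRingHom t) = M := by
      intro l M; ext i j; simp
    rw [Matrix.map_add _ (map_add _), Matrix.map_mul, h1, h3, h3]
  have hdet : ∀ t, Gp.det.eval t =
      (reachabilityMatrix (A + t • A') (B + t • B') * Q + (1 - Cm * Q)).det := by
    intro t
    rw [← hGp, ← RingHom.mapMatrix_apply, ← RingHom.map_det, coe_evalRingHom]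
  have hne : Gp.det ≠ 0 := by
    intro h
    have := hdet 0
    simp [h, ← hCm] at this
  filter_upwards [Polynomial.eventually_atTop_not_isRoot _ hne] with t ht r hr
  have hunit : IsUnit (reachabilityMatrix (A + t • A') (B + t • B') * Q + (1 - Cm * Q)) := by
    rw [Matrix.isUnit_iff_isUnit_det, ← hdet]
    exact isUnit_iff_ne_zero.2 ht
  obtain ⟨w, hw⟩ := (Matrix.mulVec_surjective_iff_isUnit.2 hunit) r
  rw [add_mulVec, sub_mulVec, one_mulVec, hQ, ← mulVec_mulVec] at hw
  have hmem : ∀ v, reachabilityMatrix (A + t • A') (B + t • B') *ᵥ v ∈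
      reachableSubspace (A + t • A') (B + t • B') := fun v => ⟨v, rfl⟩
  have hle : reachableSubspace (A + t • A') (B + t • B') ≤ R := by
    refine reachableSubspace_le (fun x hx => ?_) (fun u => ?_)
    · rw [add_mulVec, smul_mulVec]
      exact R.add_mem (reachableSubspace_invariant A B x hx) (R.smul_mem _ (hA' x))
    · rw [add_mulVec, smul_mulVec]
      exact R.add_mem (mulVec_mem_reachableSubspace A B u) (R.smul_mem _ (hB' u))
  -- All other terms of the equation lie in R, hence so does w, and the correction `1 - Cm * Q`
  -- kills it.
  have hwR : w ∈ R := by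
    have h1 : w = r - reachabilityMatrix (A + t • A') (B + t • B') *ᵥ (Q *ᵥ w) + p w := by
      rw [← hw]; abel
    rw [h1]
    exact R.add_mem (R.sub_mem hr (hle (hmem _))) (p w).2
  rw [hp' w hwR, sub_self, add_zero] at hw
  rw [← hw]
  exact hmem _

theorem eventually_mem_stabilizableSystems {n m : ℕ} {A A' : Matrix (Fin n) (Fin n) ℝ}
    {B B' : Matrix (Fin n) (Fin m) ℝ} (hAB : (A, B) ∈ stabilizableSystems n m)
    (hA' : ∀ x, A' *ᵥ x ∈ reachableSubspace A B)
    (hB' : ∀ u, B' *ᵥ u ∈ reachableSubspace A B) :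
    ∀ᶠ t : ℝ in atTop, (A + t • A', B + t • B') ∈ stabilizableSystems n m := by
  obtain ⟨F₀, hF₀⟩ := hAB
  filter_upwards [eventually_reachableSubspace_le A A' B B' hA' hB'] with t ht
  obtain ⟨F, hF⟩ := exists_deadbeat (A + t • A') (B + t • B')
  have hB : ∀ u, (B + t • B') *ᵥ u ∈ reachableSubspace A B := fun u => by
    rw [add_mulVec, smul_mulVec]
    exact Submodule.add_mem _ (mulVec_mem_reachableSubspace A B u) (Submodule.smul_mem _ _ (hB' u))
  refine ⟨F, hF₀.of_congr_mod (reachableSubspace A B) (fun x hx => ?_) (fun x => ?_) n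
    fun x hx => hF x (ht hx)⟩
  · simp only
    rw [add_mulVec, ← mulVec_mulVec]
    refine Submodule.add_mem _ ?_ (hB _)
    rw [add_mulVec, smul_mulVec]
    exact Submodule.add_mem _ (reachableSubspace_invariant A B x hx)
      (Submodule.smul_mem _ _ (hA' x))
  · have h1 : (A + t • A' + (B + t • B') * F - (A + B * F₀)) *ᵥ x =
        t • (A' *ᵥ x) + (B + t • B') *ᵥ (F *ᵥ x) - B *ᵥ (F₀ *ᵥ x) := by
      simp only [sub_mulVec, add_mulVec, ← mulVec_mulVec, smul_mulVec]
      abel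
    simp only [h1]
    exact Submodule.sub_mem _ (Submodule.add_mem _ (Submodule.smul_mem _ _ (hA' x)) (hB _))
      (mulVec_mem_reachableSubspace A B _)

theorem exists_dotProduct_ne_zero {ι : Type*} [Fintype ι] {p : Submodule ℝ (ι → ℝ)} {v : ι → ℝ}
    (hv : v ∉ p) : ∃ c : ι → ℝ, c ⬝ᵥ v ≠ 0 ∧ ∀ w ∈ p, c ⬝ᵥ w = 0 := by
  classical
  obtain ⟨f, hfv, hp⟩ := Submodule.exists_le_ker_of_notMem hv
  have hf : ∀ w, (fun i => f (Pi.single i 1)) ⬝ᵥ w = f w := by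
    intro w
    conv_rhs => rw [← Finset.univ_sum_single w, map_sum]
    refine Finset.sum_congr rfl fun i _ => ?_
    rw [mul_comm, ← smul_eq_mul, ← map_smul, ← Pi.single_smul, smul_eq_mul, mul_one]
  exact ⟨fun i => f (Pi.single i 1), by rwa [hf], fun w hw => by rw [hf]; exact hp hw⟩

/-! ### Consequences of a common stabilizing gain -/

namespace Data

variable {n m T : ℕ} {D : Data n m T}

theorem add_smul_mul_mem_consistentSystems {A A₀ : Matrix (Fin n) (Fin n) ℝ}
    {B B₀ : Matrix (Fin n) (Fin m) ℝ} (h : (A, B) ∈ D.consistentSystems)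
    (h₀ : (A₀, B₀) ∈ D.homogeneousSystems) (t : ℝ) :
    (A + t • A₀, B + t • B₀) ∈ D.consistentSystems := by
  simp only [consistentSystems, homogeneousSystems, Set.mem_ofPred_eq] at h h₀ ⊢
  have : (A + t • A₀) * D.Xminus + (B + t • B₀) * D.Uminus =
      (A * D.Xminus + B * D.Uminus) + t • (A₀ * D.Xminus + B₀ * D.Uminus) := by
    simp only [Matrix.add_mul, Matrix.smul_mul, smul_add]
    abel
  rw [this, h₀, h, smul_zero, add_zero]

theorem mul_mem_homogeneousSystems {A₀ : Matrix (Fin n) (Fin n) ℝ}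
    {B₀ : Matrix (Fin n) (Fin m) ℝ} (h₀ : (A₀, B₀) ∈ D.homogeneousSystems)
    (S : Matrix (Fin n) (Fin n) ℝ) : (S * A₀, S * B₀) ∈ D.homogeneousSystems := by
  simp only [homogeneousSystems, Set.mem_ofPred_eq] at h₀ ⊢
  rw [Matrix.mul_assoc, Matrix.mul_assoc, ← Matrix.mul_add, h₀, Matrix.mul_zero]

theorem vecMulVec_mem_homogeneousSystems {p : Fin n → ℝ} {q : Fin m → ℝ}
    (h : p ᵥ* D.Xminus + q ᵥ* D.Uminus = 0) (a : Fin n → ℝ) :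
    (vecMulVec a p, vecMulVec a q) ∈ D.homogeneousSystems := by
  simp only [homogeneousSystems, Set.mem_ofPred_eq]
  rw [vecMulVec_mul, vecMulVec_mul, ← vecMulVec_add, h]
  ext; simp [vecMulVec]

/-- The gain `K` makes every stabilizable system consistent with the data Schur. -/
def IsCommonGain (D : Data n m T) (K : Matrix (Fin m) (Fin n) ℝ) : Prop :=
  ∀ (A : Matrix (Fin n) (Fin n) ℝ) (B : Matrix (Fin n) (Fin m) ℝ),
    (A, B) ∈ D.consistentSystems ∩ stabilizableSystems n m → IsSchur (A + B * K)

theorem IsCommonGain.mulVec_eq_zero {K : Matrix (Fin m) (Fin n) ℝ} (hK : D.IsCommonGain K)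
    {A A₀ : Matrix (Fin n) (Fin n) ℝ} {B B₀ : Matrix (Fin n) (Fin m) ℝ}
    (hAB : (A, B) ∈ D.consistentSystems ∩ stabilizableSystems n m)
    (h₀ : (A₀, B₀) ∈ D.homogeneousSystems) {r : Fin n → ℝ} (hr : r ∈ reachableSubspace A B) :
    (A₀ + B₀ * K) *ᵥ r = 0 := by
  set v := (A₀ + B₀ * K) *ᵥ r with hv
  -- The image of S lies in the reachable subspace, and S (A₀ + B₀K) has trace v ⬝ᵥ v.
  let S : Matrix (Fin n) (Fin n) ℝ := vecMulVec r v
  have hS : ∀ x, S *ᵥ x ∈ reachableSubspace A B := fun x => by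
    have : S *ᵥ x = (v ⬝ᵥ x) • r := by
      ext i; simp [S, vecMulVec_mulVec, mul_comm]
    rw [this]
    exact Submodule.smul_mem _ _ hr
  have hev := eventually_mem_stabilizableSystems (A' := S * A₀) (B' := S * B₀) hAB.2
    (fun x => by rw [← mulVec_mulVec]; exact hS _) (fun x => by rw [← mulVec_mulVec]; exact hS _)
  have htr : ∀ t : ℝ, (A + t • (S * A₀) + (B + t • (S * B₀)) * K).trace =
      (A + B * K).trace + t * (v ⬝ᵥ v) := by
    intro t
    have h1 : A + t • (S * A₀) + (B + t • (S * B₀)) * K =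
        (A + B * K) + t • (S * (A₀ + B₀ * K)) := by
      simp only [Matrix.add_mul, Matrix.mul_add, Matrix.smul_mul, smul_add, Matrix.mul_assoc]
      abel
    rw [h1, trace_add, trace_smul, vecMulVec_mul, trace_vecMulVec, dotProduct_comm,
      ← dotProduct_mulVec, ← hv, smul_eq_mul]
  have hle : ∀ᶠ t : ℝ in atTop, (A + B * K).trace + t * (v ⬝ᵥ v) ≤ n := by
    filter_upwards [hev] with t ht
    rw [← htr]
    exact (le_abs_self _).trans (hK _ _ ⟨add_smul_mul_mem_consistentSystems hAB.1
      (mul_mem_homogeneousSystems h₀ S) t, ht⟩).abs_trace_le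
  by_contra hne
  have hpos : 0 < v ⬝ᵥ v := lt_of_le_of_ne
    (Finset.sum_nonneg fun i _ => mul_self_nonneg (v i))
    (fun h => hne (dotProduct_self_eq_zero.1 h.symm))
  have htop : Tendsto (fun t : ℝ => (A + B * K).trace + t * (v ⬝ᵥ v)) atTop atTop :=
    tendsto_atTop_add_const_left _ _ (tendsto_id.atTop_mul_const hpos)
  obtain ⟨t, h1, h2⟩ := (hle.and (htop.eventually_gt_atTop (n : ℝ))).exists
  exact absurd h2 (not_lt.2 h1)

theorem IsCommonGain.dotProduct_eq_zero {K : Matrix (Fin m) (Fin n) ℝ} (hK : D.IsCommonGain K)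
    {A : Matrix (Fin n) (Fin n) ℝ} {B : Matrix (Fin n) (Fin m) ℝ}
    (hAB : (A, B) ∈ D.consistentSystems ∩ stabilizableSystems n m)
    {ξ : Fin n → ℝ} (hξ : ξ ᵥ* D.Xminus = 0) {r : Fin n → ℝ} (hr : r ∈ reachableSubspace A B) :
    ξ ⬝ᵥ r = 0 := by
  have h := hK.mulVec_eq_zero hAB
    (vecMulVec_mem_homogeneousSystems (p := ξ) (q := 0) (by simp [hξ]) ξ) hr
  have h1 : (ξ ⬝ᵥ r) • ξ = 0 := by
    rw [← h]
    ext i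
    simp [add_mulVec, ← mulVec_mulVec, vecMulVec_mulVec, mul_comm]
  rcases smul_eq_zero.1 h1 with h2 | h2
  · exact h2
  · simp [h2]

theorem vecMul_Xminus_eq_zero {ξ : Fin n → ℝ} (h : ∀ x ∈ im D.Xminus, ξ ⬝ᵥ x = 0) :
    ξ ᵥ* D.Xminus = 0 := by
  refine _root_.dotProduct_eq_zero _ fun w => ?_
  rw [← dotProduct_mulVec]
  exact h _ ⟨w, rfl⟩

theorem IsCommonGain.reachableSubspace_le {K : Matrix (Fin m) (Fin n) ℝ} (hK : D.IsCommonGain K)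
    {A : Matrix (Fin n) (Fin n) ℝ} {B : Matrix (Fin n) (Fin m) ℝ}
    (hAB : (A, B) ∈ D.consistentSystems ∩ stabilizableSystems n m) :
    reachableSubspace A B ≤ im D.Xminus := by
  intro r hr
  by_contra hrX
  obtain ⟨c, hc, hcX⟩ := exists_dotProduct_ne_zero hrX
  exact hc (hK.dotProduct_eq_zero hAB (vecMul_Xminus_eq_zero hcX) hr)

theorem exists_vecMul_Xminus_eq_zero (hrank : D.Xminus.rank < n) :
    ∃ ξ : Fin n → ℝ, ξ ≠ 0 ∧ ξ ᵥ* D.Xminus = 0 := by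
  have hX : ∃ v, v ∉ im D.Xminus := by
    by_contra! h
    have h1 : LinearMap.range D.Xminus.mulVecLin = ⊤ := Submodule.eq_top_iff'.2 h
    rw [Matrix.rank, h1, finrank_top, Module.finrank_fin_fun] at hrank
    exact lt_irrefl _ hrank
  obtain ⟨v, hv⟩ := hX
  obtain ⟨c, hc, hcX⟩ := exists_dotProduct_ne_zero hv
  exact ⟨c, fun h => hc (by simp [h]), vecMul_Xminus_eq_zero hcX⟩

/-- Adding tξqᵀ to B moves Bq by t(q ⬝ᵥ q)ξ, while ξ must stay orthogonal to Bq before and after the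
perturbation. -/
theorem IsCommonGain.annihilator_snd_eq_zero {K : Matrix (Fin m) (Fin n) ℝ}
    (hK : D.IsCommonGain K) {A : Matrix (Fin n) (Fin n) ℝ} {B : Matrix (Fin n) (Fin m) ℝ}
    (hAB : (A, B) ∈ D.consistentSystems ∩ stabilizableSystems n m) (hrank : D.Xminus.rank < n)
    {p : Fin n → ℝ} {q : Fin m → ℝ} (hpq : p ᵥ* D.Xminus + q ᵥ* D.Uminus = 0) : q = 0 := by
  obtain ⟨ξ, hξ0, hξ⟩ := exists_vecMul_Xminus_eq_zero hrank
  obtain ⟨F, hF⟩ := hAB.2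
  have hev : ∀ᶠ t : ℝ in 𝓝 0,
      IsSchur (A + t • vecMulVec ξ p + (B + t • vecMulVec ξ q) * F) := by
    refine IsSchur.eventually (M := fun t : ℝ =>
      A + t • vecMulVec ξ p + (B + t • vecMulVec ξ q) * F) ?_ (by simpa using hF)
    fun_prop
  -- Openness of the Schur property lets the same F stabilize for some small t ≠ 0.
  obtain ⟨t, ht, ht0⟩ := ((hev.filter_mono nhdsWithin_le_nhds).and
    (self_mem_nhdsWithin : {(0 : ℝ)}ᶜ ∈ 𝓝[≠] (0 : ℝ))).exists
  have h0 := hK.dotProduct_eq_zero hAB hξ (mulVec_mem_reachableSubspace A B q)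
  have h1 := hK.dotProduct_eq_zero ⟨add_smul_mul_mem_consistentSystems hAB.1
    (vecMulVec_mem_homogeneousSystems hpq ξ) t, F, ht⟩ hξ
    (mulVec_mem_reachableSubspace _ (B + t • vecMulVec ξ q) q)
  have h2 : (vecMulVec ξ q) *ᵥ q = (q ⬝ᵥ q) • ξ := by
    ext i; simp [vecMulVec_mulVec, mul_comm]
  rw [add_mulVec, smul_mulVec, h2, dotProduct_add, h0, zero_add, dotProduct_smul,
    dotProduct_smul, smul_eq_mul, smul_eq_mul] at h1
  rcases mul_eq_zero.1 h1 with h3 | h3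
  · exact absurd h3 ht0
  rcases mul_eq_zero.1 h3 with h4 | h4
  · exact dotProduct_self_eq_zero.1 h4
  · exact absurd (dotProduct_self_eq_zero.1 h4) hξ0

theorem IsCommonGain.exists_mulVec_eq {K : Matrix (Fin m) (Fin n) ℝ}
    (hK : D.IsCommonGain K) {A : Matrix (Fin n) (Fin n) ℝ} {B : Matrix (Fin n) (Fin m) ℝ}
    (hAB : (A, B) ∈ D.consistentSystems ∩ stabilizableSystems n m) (hrank : D.Xminus.rank < n)
    {x : Fin n → ℝ} (hx : x ∈ im D.Xminus) (u : Fin m → ℝ) :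
    ∃ w, D.Xminus *ᵥ w = x ∧ D.Uminus *ᵥ w = u := by
  by_contra! hne
  have hz : Sum.elim x u ∉ im (fromRows D.Xminus D.Uminus) := by
    rintro ⟨w, hw⟩
    rw [mulVecLin_apply, fromRows_mulVec, Sum.elim_eq_iff] at hw
    exact hne w hw.1 hw.2
  obtain ⟨c, hc, hcX⟩ := exists_dotProduct_ne_zero hz
  have hc' : ∀ (y : Fin n → ℝ) (z : Fin m → ℝ),
      c ⬝ᵥ Sum.elim y z = (c ∘ Sum.inl) ⬝ᵥ y + (c ∘ Sum.inr) ⬝ᵥ z := by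
    intro y z
    simp [dotProduct]
  have hpq : (c ∘ Sum.inl) ᵥ* D.Xminus + (c ∘ Sum.inr) ᵥ* D.Uminus = 0 := by
    refine _root_.dotProduct_eq_zero _ fun w => ?_
    rw [add_dotProduct, ← dotProduct_mulVec, ← dotProduct_mulVec, ← hc', ← fromRows_mulVec]
    exact hcX _ ⟨w, rfl⟩
  have hq := hK.annihilator_snd_eq_zero hAB hrank hpq
  rw [hq, zero_vecMul, add_zero] at hpq
  obtain ⟨w, rfl⟩ := hx
  rw [hc', hq, zero_dotProduct, add_zero, mulVecLin_apply, dotProduct_mulVec, hpq,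
    zero_dotProduct] at hc
  exact hc rfl

theorem CollectedFrom.mem_consistentSystems {A : Matrix (Fin n) (Fin n) ℝ}
    {B : Matrix (Fin n) (Fin m) ℝ} (hD : D.CollectedFrom A B) : (A, B) ∈ D.consistentSystems := by
  ext i t
  exact congrFun (hD t) i

theorem state_mem_im_Xminus (t : Fin T) : D.x t.castSucc ∈ im D.Xminus :=
  ⟨Pi.single t 1, by rw [mulVecLin_apply, mulVec_single_one]; rfl⟩

/-- If the states `x(0), …, x(T-1)` are linearly dependent, then the trajectory stays in any
subspace that contains them together with the reachable subspace. -/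
theorem CollectedFrom.state_mem {A : Matrix (Fin n) (Fin n) ℝ} {B : Matrix (Fin n) (Fin m) ℝ}
    (hD : D.CollectedFrom A B) {W : Submodule ℝ (Fin n → ℝ)} (hR : reachableSubspace A B ≤ W)
    (hW : ∀ t : Fin T, D.x t.castSucc ∈ W) {c : Fin T → ℝ} (hc : c ≠ 0)
    (hXc : D.Xminus *ᵥ c = 0) (t : Fin (T + 1)) : D.x t ∈ W := by
  have hsum : ∑ i, c i • D.x i.castSucc = 0 := by
    rw [← hXc]
    ext i
    simp [mulVec, dotProduct, Xminus, mul_comm]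
  -- With j the last index of a nonzero coefficient, x(j) lies in the span of its predecessors.
  obtain ⟨j, hj, hjmax⟩ : ∃ j, c j ≠ 0 ∧ ∀ i, j < i → c i = 0 := by
    obtain ⟨i, hi⟩ := Function.ne_iff.1 hc
    obtain ⟨j, hj⟩ := (Set.toFinite {i | c i ≠ 0}).exists_maximal ⟨i, hi⟩
    refine ⟨j, hj.1, fun i hi => ?_⟩
    by_contra h
    exact absurd hi (not_lt.2 (hj.2 h hi.le))
  let G : Submodule ℝ (Fin n → ℝ) :=
    Submodule.span ℝ ((fun i : Fin T => D.x i.castSucc) '' {i | i < j})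
  have hgen : ∀ i : Fin T, i < j → D.x i.castSucc ∈ G := fun i hi =>
    Submodule.subset_span ⟨i, hi, rfl⟩
  have hxj : D.x j.castSucc ∈ G := by
    rw [← Finset.add_sum_erase _ _ (Finset.mem_univ j)] at hsum
    have h1 : c j • D.x j.castSucc ∈ G := by
      rw [eq_neg_of_add_eq_zero_left hsum]
      refine G.neg_mem (G.sum_mem fun i hi => ?_)
      rcases lt_or_gt_of_ne (Finset.ne_of_mem_erase hi) with h | h
      · exact G.smul_mem _ (hgen i h)
      · simp [hjmax i h]
    exact (G.smul_mem_iff hj).1 h1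
  let S := G ⊔ reachableSubspace A B
  have hSW : S ≤ W := by
    refine sup_le (Submodule.span_le.2 ?_) hR
    rintro _ ⟨i, -, rfl⟩
    exact hW i
  have hle : ∀ i : Fin T, i ≤ j → D.x i.castSucc ∈ G := fun i hi => by
    rcases hi.eq_or_lt with rfl | h
    · exact hxj
    · exact hgen i h
  have hB : ∀ u, B *ᵥ u ∈ S := fun u =>
    (le_sup_right : _ ≤ S) (mulVec_mem_reachableSubspace A B u)
  -- For i < j, A x(i) = x(i+1) - B u(i) with i + 1 ≤ j, so S is A-invariant.
  have hA : S ≤ S.comap A.mulVecLin := by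
    refine sup_le (Submodule.span_le.2 ?_) fun x hx =>
      (le_sup_right : _ ≤ S) (reachableSubspace_invariant A B x hx)
    rintro _ ⟨i, hi, rfl⟩
    have hi' : i.val + 1 ≤ j.val := hi
    have h1 := hle ⟨i + 1, by omega⟩ hi'
    have h2 : D.x (Fin.castSucc ⟨i + 1, by omega⟩) =
      A *ᵥ D.x i.castSucc + B *ᵥ D.u i := hD i
    have h3 : A *ᵥ D.x i.castSucc = D.x (Fin.castSucc ⟨i + 1, by omega⟩) - B *ᵥ D.u i := by
      rw [h2]; abel
    change A *ᵥ D.x i.castSucc ∈ S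
    rw [h3]
    exact S.sub_mem ((le_sup_left : G ≤ S) h1) (hB _)
  refine hSW ?_
  induction t using Fin.induction with
  | zero => exact (le_sup_left : G ≤ S) (hle ⟨0, by have := j.2; omega⟩ (Nat.zero_le _))
  | succ t ih =>
    rw [hD t]
    exact S.add_mem (hA ih) (hB _)

theorem IsCommonGain.im_Xplus_le {K : Matrix (Fin m) (Fin n) ℝ}
    (hK : D.IsCommonGain K) (hm : 0 < m) {A : Matrix (Fin n) (Fin n) ℝ}
    {B : Matrix (Fin n) (Fin m) ℝ} (hD : D.CollectedFrom A B)
    (hAB : (A, B) ∈ stabilizableSystems n m) (hrank : D.Xminus.rank < n) :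
    im D.Xplus ≤ im D.Xminus := by
  have hAB' := And.intro hD.mem_consistentSystems hAB
  -- Zero state with a nonzero input forces c ≠ 0; such an input exists because m > 0.
  obtain ⟨c, hXc, hUc⟩ := hK.exists_mulVec_eq hAB' hrank (Submodule.zero_mem _)
    (Pi.single ⟨0, hm⟩ 1)
  have hc : c ≠ 0 := by
    rintro rfl
    rw [mulVec_zero] at hUc
    simpa using congrFun hUc ⟨0, hm⟩
  rw [im, Matrix.range_mulVecLin, Submodule.span_le]
  rintro _ ⟨t, rfl⟩
  exact hD.state_mem (hK.reachableSubspace_le hAB') state_mem_im_Xminus hc hXc t.succ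

end Data

end DataDriven

/-! ### The main theorem -/

theorem theorem2 {n m T : ℕ} (hn : 0 < n) (hm : 0 < m) (hT : 0 < T)
    (Atrue : Matrix (Fin n) (Fin n) ℝ) (Btrue : Matrix (Fin n) (Fin m) ℝ)
    (D : DataDriven.Data n m T) (hD : D.CollectedFrom Atrue Btrue)
    (hstab : (Atrue, Btrue) ∈ DataDriven.stabilizableSystems n m)
    (K : Matrix (Fin m) (Fin n) ℝ)
    (hK : ∀ (A : Matrix (Fin n) (Fin n) ℝ) (B : Matrix (Fin n) (Fin m) ℝ),
      (A, B) ∈ D.consistentSystems ∩ DataDriven.stabilizableSystems n m →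
        DataDriven.IsSchur (A + B * K)) :
    (∀ (A : Matrix (Fin n) (Fin n) ℝ) (B : Matrix (Fin n) (Fin m) ℝ),
      (A, B) ∈ D.consistentSystems ∩ DataDriven.stabilizableSystems n m →
      ∀ (A₀ : Matrix (Fin n) (Fin n) ℝ) (B₀ : Matrix (Fin n) (Fin m) ℝ),
        (A₀, B₀) ∈ D.homogeneousSystems →
        (DataDriven.reachableSubspace A B).map (A₀ + B₀ * K).mulVecLin = ⊥) ∧
    (D.Xminus.rank < n →
      (DataDriven.im (Matrix.fromRows D.Xminus D.Uminus)).map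
          (LinearEquiv.sumArrowLequivProdArrow (Fin n) (Fin m) ℝ ℝ).toLinearMap =
        (DataDriven.im D.Xminus).prod ⊤) ∧
    DataDriven.im D.Xplus ≤ DataDriven.im D.Xminus ∧
    (∀ (A : Matrix (Fin n) (Fin n) ℝ) (B : Matrix (Fin n) (Fin m) ℝ),
      (A, B) ∈ D.consistentSystems →
      (DataDriven.im D.Xminus).map A.mulVecLin ≤ DataDriven.im D.Xminus ∧
      DataDriven.im B ≤ DataDriven.im D.Xminus) := by
  have hG : D.IsCommonGain K := hK
  have htrue := And.intro hD.mem_consistentSystems hstab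
  have htop : ¬ D.Xminus.rank < n → DataDriven.im D.Xminus = ⊤ := by
    intro h
    apply Submodule.eq_top_of_finrank_eq
    rw [Module.finrank_fin_fun]
    exact le_antisymm (D.Xminus.rank_le_height) (not_lt.1 h)
  have hplus : DataDriven.im D.Xplus ≤ DataDriven.im D.Xminus := by
    by_cases h : D.Xminus.rank < n
    · exact hG.im_Xplus_le hm hD hstab h
    · rw [htop h]
      exact le_top
  refine ⟨fun A B hAB A₀ B₀ h₀ => ?_, fun hrank => ?_, hplus, fun A B hAB => ?_⟩
  · rw [Submodule.eq_bot_iff]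
    rintro _ ⟨r, hr, rfl⟩
    exact hG.mulVec_eq_zero hAB h₀ hr
  · ext ⟨x, u⟩
    simp only [Submodule.mem_map, Submodule.mem_prod, Submodule.mem_top, and_true]
    constructor
    · rintro ⟨_, ⟨w, rfl⟩, hw⟩
      refine ⟨w, ?_⟩
      refine Eq.trans ?_ (congrArg Prod.fst hw)
      ext i
      simp [Matrix.fromRows_mulVec]
    · intro hx
      obtain ⟨w, rfl, rfl⟩ := hG.exists_mulVec_eq htrue hrank hx u
      refine ⟨_, ⟨w, rfl⟩, ?_⟩
      ext i <;> simp [Matrix.fromRows_mulVec]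
  · by_cases hrank : D.Xminus.rank < n
    · have key : ∀ x ∈ DataDriven.im D.Xminus, ∀ u,
          A.mulVec x + B.mulVec u ∈ DataDriven.im D.Xminus := by
        intro x hx u
        obtain ⟨w, rfl, rfl⟩ := hG.exists_mulVec_eq htrue hrank hx u
        refine hplus ⟨w, ?_⟩
        have h : D.Xplus = A * D.Xminus + B * D.Uminus := hAB
        rw [h, Matrix.mulVecLin_apply, Matrix.add_mulVec, Matrix.mulVec_mulVec,
          Matrix.mulVec_mulVec]
      constructor
      · rintro _ ⟨x, hx, rfl⟩
        simpa using key x hx 0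
      · rintro _ ⟨u, rfl⟩
        simpa using key 0 (Submodule.zero_mem _) u
    · rw [htop hrank]
      exact ⟨le_top, le_top⟩
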